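/- **Setting.** Let $K$ be a number of arms and let $\mathcal P$ be a finite polytope of probability vectors in $\mathbb R^K$, i.e., $\mathcal P$ is the convex hull of a finite set $\mathrm{Ext}(\mathcal P)$ of probability vectors over $[K]=\{1,\dots,K\}$. Assume that $\mathcal P$ puts some mass on each arm: for every $a\in[K]$ there is $p\in\mathrm{Ext}(\mathcal P)$ with $p_a>0$. A model $\mathcal D$ is a set of probability distributions over $\mathbb R$; we assume that all its elements have a finite first moment. A bandit problem in $\mathcal D$ is a vector $\nu=(\nu_1,\dots,\nu_K)$ of elements of $\mathcal D$, with vector of expectations $\mu=(\mu_1,\dots,\mu_K)$. At each round $t\ge1$ a strategy picks, based on the past (and possibly at random), a mixed action $p_t\in\mathcal P$; an arm $A_t\sim p_t$ is drawn and a reward $Y_t\sim\nu_{A_t}$ is observed. The expected regret is $$R_T(\nu)=T\max_{p\in\mathcal P}\langle p,\mu\rangle-\mathbb E\Bigl[\sum_{t=1}^T\langle p_t,\mu\rangle\Bigr].$$ A strategy is uniformly fast convergent (UFC) over $\mathcal D$ given $\mathcal P$ if $R_T(\nu')=o(T^\alpha)$ for every bandit problem $\nu'$ in $\mathcal D$ and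 every $\alpha>0$. Let $\mathrm{Opt}(\nu)=\mathrm{argmax}_{p\in\mathcal P}\langle p,\mu\rangle$ and $\Delta(p)=\max_{q\in\mathcal P}\langle q,\mu\rangle-\langle p,\mu\rangle$. When $\mathrm{Opt}(\nu)=\{p^\star\}$ is a singleton, let $$\mathrm{Alt}(\nu)=\bigl\{\nu'\text{ in }\mathcal D:\ p^\star\notin\mathrm{Opt}(\nu')\text{ and, for all }a\in[K],\ p^\star_a=0\text{ or }\nu_a=\nu'_a\bigr\},$$ and let $c(\mathrm{Ext}(\mathcal P),\nu)\in[0,+\infty]$ be the infimum of $\sum_{p\in\mathrm{Ext}(\mathcal P)}\Delta(p)\,n(p)$ over all $n\in[0,+\infty)^{\mathrm{Ext}(\mathcal P)}$ such that $$\forall\nu'\in\mathrm{Alt}(\nu),\qquad\sum_{p\in\mathrm{Ext}(\mathcal P),\,p\ne p^\star}n(p)\sum_{a\in[K]:\,p^\star_a=0}p_a\,\mathrm{KL}(\nu_a,\nu'_a)\ge1,$$ with the conventions $0\cdot(+\infty)=0$ and $\inf\emptyset=+\infty$. Assume finally that for every problem $\nu$ in $\mathcal D$ with a unique optimal mixed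 action, $\mathrm{Alt}(\nu)$ is either empty or contains some $\nu''$ with $\mathrm{KL}(\nu_a,\nu''_a)<+\infty$ for all $a\in[K]$. **Theorem.** For every bandit problem $\nu$ in $\mathcal D$ with a unique optimal mixed action $p^\star$: 1. every strategy that is UFC over $\mathcal D$ given $\mathcal P$ satisfies $\displaystyle\liminf_{T\to\infty}\frac{R_T(\nu)}{\log T}\ge c(\mathrm{Ext}(\mathcal P),\nu)$; 2. if $p^\star_a>0$ for all $a\in[K]$, then $c(\mathrm{Ext}(\mathcal P),\nu)=0$; 3. if the means of the distributions in $\mathcal D$ are not bounded from above and $p^\star_a=0$ for some $a\in[K]$, then $c(\mathrm{Ext}(\mathcal P),\nu)>0$. -/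

import Mathlib

open MeasureTheory ProbabilityTheory InformationTheory Filter Topology Asymptotics
open scoped ENNReal NNReal

noncomputable section

namespace DivBandit

/-- A bandit problem with `K` arms: one probability distribution over `ℝ` per arm. -/
abbrev Problem (K : ℕ) : Type := Fin K → ProbabilityMeasure ℝ

/-- The problem `ν` belongs to the model `D`: all its arms have their distribution in `D`. -/
def InModel {K : ℕ} (D : Set (ProbabilityMeasure ℝ)) (ν : Problem K) : Prop :=
  ∀ a, ν a ∈ D

/-- The expectation of a distribution over the reals. -/
def mean (ρ : ProbabilityMeasure ℝ) : ℝ := ∫ y, y ∂(ρ : Measure ℝ)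

/-- Expected payoff `⟨p, μ⟩` of the mixed action `p` in the problem `ν`. -/
def payoff {K : ℕ} (ν : Problem K) (p : Fin K → ℝ) : ℝ := ∑ a, p a * mean (ν a)

/-- Optimal expected payoff `M(μ, P) = max_{p ∈ P} ⟨p, μ⟩`. -/
def maxPayoff {K : ℕ} (P : Set (Fin K → ℝ)) (ν : Problem K) : ℝ := sSup (payoff ν '' P)

/-- The set of optimal mixed actions `argmax_{p ∈ P} ⟨p, μ⟩`. -/
def Opt {K : ℕ} (P : Set (Fin K → ℝ)) (ν : Problem K) : Set (Fin K → ℝ) :=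
  {p | p ∈ P ∧ ∀ q ∈ P, payoff ν q ≤ payoff ν p}

/-- Suboptimality gap `Δ(p) = M(μ, P) - ⟨p, μ⟩`. -/
def gap {K : ℕ} (P : Set (Fin K → ℝ)) (ν : Problem K) (p : Fin K → ℝ) : ℝ :=
  maxPayoff P ν - payoff ν p

/-! ### The interaction protocol -/

/-- One round of play `((p_t, A_t), Y_t)`: mixed action picked, arm drawn, reward observed. -/
abbrev Round (K : ℕ) : Type := (stdSimplex ℝ (Fin K) × Fin K) × ℝ

/-- A (possibly randomized) strategy playing in `P`: the mixed action for the next round is drawn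
according to a probability distribution over `P` that depends measurably on the past
(the mixed actions picked, the arms drawn and the rewards obtained). Strategies that pick the mixed
action deterministically are those whose kernels have Dirac values. -/
structure Strategy (K : ℕ) (P : Set (Fin K → ℝ)) where
  act : (t : ℕ) → Kernel (Fin t → Round K) (stdSimplex ℝ (Fin K))
  markov : ∀ t, IsMarkovKernel (act t)
  mem : ∀ t h, ∀ᵐ p ∂(act t h), p.1 ∈ P

/-- Drawing an arm `A ∼ p`. -/
def armKernel (K : ℕ) : Kernel (stdSimplex ℝ (Fin K)) (Fin K) where
  toFun p := ∑ a, ENNReal.ofReal (p.1 a) • Measure.dirac a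
  measurable' := by
    refine Measure.measurable_of_measurable_coe _ fun s _ => ?_
    simp only [Measure.finsetSum_apply, Measure.smul_apply, smul_eq_mul]
    refine Finset.measurable_sum _ fun a _ => Measurable.mul_const ?_ _
    exact ((measurable_pi_apply a).comp measurable_subtype_coe).ennreal_ofReal

instance (K : ℕ) : IsMarkovKernel (armKernel K) where
  isProbabilityMeasure p := ⟨by
    change (∑ a, ENNReal.ofReal (p.1 a) • Measure.dirac a : Measure (Fin K)) Set.univ = 1
    simp only [Measure.finsetSum_apply, Measure.smul_apply, smul_eq_mul, measure_univ, mul_one]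
    rw [← ENNReal.ofReal_sum_of_nonneg fun a _ => p.2.1 a, p.2.2, ENNReal.ofReal_one]⟩

/-- Drawing a reward `Y ∼ ν_A`. -/
def rewardKernel {K : ℕ} (ν : Problem K) : Kernel (Fin K) ℝ where
  toFun a := (ν a : Measure ℝ)
  measurable' := measurable_of_countable _

instance {K : ℕ} (ν : Problem K) : IsMarkovKernel (rewardKernel ν) where
  isProbabilityMeasure a := inferInstanceAs (IsProbabilityMeasure (ν a : Measure ℝ))

/-- Conditional law of round `t + 1` given the first `t` rounds: the strategy picks `p`, then
`A ∼ p` is drawn, then `Y ∼ ν_A` is drawn. -/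
def roundKernel {K : ℕ} {P : Set (Fin K → ℝ)} (ψ : Strategy K P) (ν : Problem K) (t : ℕ) :
    Kernel (Fin t → Round K) (Round K) :=
  (ψ.act t).compProd ((armKernel K).comap Prod.snd measurable_snd)
    |>.compProd ((rewardKernel ν).comap (fun x => x.2.2) (measurable_snd.comp measurable_snd))

instance {K : ℕ} {P : Set (Fin K → ℝ)} (ψ : Strategy K P) (ν : Problem K) (t : ℕ) :
    IsMarkovKernel (roundKernel ψ ν t) := by
  have := ψ.markov t
  unfold roundKernel
  infer_instance

theorem measurable_snoc (K t : ℕ) :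
    Measurable fun x : (Fin t → Round K) × Round K =>
      (Fin.snoc (α := fun _ => Round K) x.1 x.2 : Fin (t + 1) → Round K) := by
  refine measurable_pi_iff.2 fun i => ?_
  refine Fin.lastCases ?_ (fun j => ?_) i
  · simpa using measurable_snd
  · simpa [Function.comp_def] using
      (measurable_pi_apply (X := fun _ : Fin t => Round K) j).comp
        (measurable_fst (α := Fin t → Round K) (β := Round K))

/-- Law of the first `t` rounds when the strategy `ψ` faces the problem `ν`. -/
def histLaw {K : ℕ} {P : Set (Fin K → ℝ)} (ψ : Strategy K P) (ν : Problem K) :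
    (t : ℕ) → Measure (Fin t → Round K)
  | 0 => Measure.dirac Fin.elim0
  | t + 1 => ((histLaw ψ ν t).compProd (roundKernel ψ ν t)).map
      fun x => Fin.snoc (α := fun _ => Round K) x.1 x.2

instance {K : ℕ} {P : Set (Fin K → ℝ)} (ψ : Strategy K P) (ν : Problem K) (t : ℕ) :
    IsProbabilityMeasure (histLaw ψ ν t) := by
  induction t with
  | zero => unfold histLaw; infer_instance
  | succ t ih =>
    unfold histLaw
    exact Measure.isProbabilityMeasure_map (measurable_snoc K t).aemeasurable

/-- Expected regret `R_T(ν) = T max_{p ∈ P} ⟨p, μ⟩ - E[∑_{t ≤ T} ⟨p_t, μ⟩]`. -/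
def regret {K : ℕ} {P : Set (Fin K → ℝ)} (ψ : Strategy K P) (ν : Problem K) (T : ℕ) : ℝ :=
  T * maxPayoff P ν - ∫ h, ∑ t, payoff ν (h t).1.1.1 ∂(histLaw ψ ν T)

/-- Uniformly fast convergent strategies over the model `D` given `P`: on all problems in `D`,
the regret is `o(T ^ α)` for all `α > 0`. -/
def IsUFC {K : ℕ} {P : Set (Fin K → ℝ)} (D : Set (ProbabilityMeasure ℝ)) (ψ : Strategy K P) :
    Prop :=
  ∀ ν : Problem K, InModel D ν → ∀ α : ℝ, 0 < α →
    (fun T : ℕ => regret ψ ν T) =o[atTop] fun T : ℕ => (T : ℝ) ^ α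

/-! ### Confusing alternative problems and the constrained infimum -/

/-- The set of confusing alternative problems of the problem `ν` with unique optimal mixed
action `pstar`: problems in the model for which `pstar` is suboptimal and that cannot be told apart
from `ν` by playing `pstar` only. -/
def Conf {K : ℕ} (P : Set (Fin K → ℝ)) (D : Set (ProbabilityMeasure ℝ)) (ν : Problem K)
    (pstar : Fin K → ℝ) : Set (Problem K) :=
  {ν' | InModel D ν' ∧ pstar ∉ Opt P ν' ∧ ∀ a, pstar a = 0 ∨ ν a = ν' a}

/-- For all problems in the model with a unique optimal mixed action, the set of confusing
alternative problems is either empty or contains a problem at finite Kullback-Leibler divergence,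
arm by arm. -/
def FiniteKLAlternative {K : ℕ} (P : Set (Fin K → ℝ)) (D : Set (ProbabilityMeasure ℝ)) : Prop :=
  ∀ (ν : Problem K) (pstar : Fin K → ℝ), InModel D ν → Opt P ν = {pstar} →
    Conf P D ν pstar = ∅ ∨
      ∃ ν' ∈ Conf P D ν pstar, ∀ a, klDiv (ν a : Measure ℝ) (ν' a : Measure ℝ) < ∞

open Classical in
/-- The constraints on the allocations `n ∈ ℝ₊^E` (with the convention `0 * ∞ = 0`): for all
confusing alternative problems `ν'`,
`∑_{p ∈ E, p ≠ pstar} n(p) ∑_{a : pstar_a = 0} p_a KL(ν_a, ν'_a) ≥ 1`. -/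
def Feasible {K : ℕ} (P : Set (Fin K → ℝ)) (E : Finset (Fin K → ℝ))
    (D : Set (ProbabilityMeasure ℝ)) (ν : Problem K) (pstar : Fin K → ℝ) (n : E → ℝ≥0) : Prop :=
  ∀ ν' ∈ Conf P D ν pstar,
    1 ≤ ∑ p : E with p.1 ≠ pstar, (n p : ℝ≥0∞) *
      ∑ a : Fin K with pstar a = 0,
        ENNReal.ofReal (p.1 a) * klDiv (ν a : Measure ℝ) (ν' a : Measure ℝ)

/-- The constrained infimum `c(E, ν)`, an element of `[0, +∞]` (equal to `+∞` when no allocation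
satisfies the constraints): infimum of `∑_{p ∈ E} Δ(p) n(p)` over the feasible allocations `n`. -/
def lowerConst {K : ℕ} (P : Set (Fin K → ℝ)) (E : Finset (Fin K → ℝ))
    (D : Set (ProbabilityMeasure ℝ)) (ν : Problem K) (pstar : Fin K → ℝ) : ℝ≥0∞ :=
  ⨅ (n : E → ℝ≥0) (_ : Feasible P E D ν pstar n),
    ∑ p : E, ENNReal.ofReal (gap P ν p.1) * (n p : ℝ≥0∞)

end DivBandit

end

/-! The lower bound is a change of measure. A confusing problem `ν'` differs from `ν` only on arms
that `pstar` never draws, and no mixed action is close to optimal in both problems. A UFC strategy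
therefore produces histories that look very different under `ν` and `ν'`, and telling them apart at
polynomially small error costs about `log T` units of relative entropy. This entropy is at most the
expected cumulated divergence of the mixed actions played (`entropyBound_histLaw`);
`mul_one_sub_regret_le` combines the two facts. Both the regret and the divergence are linear in the
mixed action, so they depend only on a weight vector on `E` (`exists_weights`). If the regret were
below `r * log T` infinitely often, the weights divided by `log T`, with `pstar` left out, would
have a limit point of cost at most `r` satisfying every constraint of finite divergence
(`exists_allocation`). An arbitrarily small increase settles the constraints of infinite divergence
(`feasible_add`), whence the constrained infimum is at most `r`. Statements 2 and 3 concern the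
infimum alone: without alternatives the zero allocation is feasible, whereas one alternative at
finite divergence bounds the total weight from below. -/

/-! ### Relative entropy in variational form -/

/-- The relative entropy of `μ` with respect to `μ'` is at most `C`, in the variational form of
Donsker and Varadhan, tested on bounded measurable functions. -/
def EntropyBound {α : Type*} [MeasurableSpace α] (μ μ' : Measure α) (C : ℝ) : Prop :=
  ∀ g : α → ℝ, Measurable g → (∃ B, ∀ x, |g x| ≤ B) →
    ∫ x, g x ∂μ ≤ C + Real.log (∫ x, Real.exp (g x) ∂μ')

theorem integrable_of_abs_le {α : Type*} [MeasurableSpace α] {μ : Measure α} [IsFiniteMeasure μ]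
    {g : α → ℝ} (hg : Measurable g) {B : ℝ} (hB : ∀ x, |g x| ≤ B) : Integrable g μ :=
  Integrable.of_bound hg.aestronglyMeasurable B (Eventually.of_forall fun x => hB x)

theorem integrable_exp_of_abs_le {α : Type*} [MeasurableSpace α] {μ : Measure α}
    [IsFiniteMeasure μ] {g : α → ℝ} (hg : Measurable g) {B : ℝ} (hB : ∀ x, |g x| ≤ B) :
    Integrable (fun x => Real.exp (g x)) μ :=
  integrable_of_abs_le (B := Real.exp B) hg.exp fun x => by
    rw [abs_of_pos (Real.exp_pos _)]
    exact Real.exp_le_exp.2 (abs_le.1 (hB x)).2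

theorem abs_integral_le_of_abs_le {α : Type*} [MeasurableSpace α] {μ : Measure α}
    [IsProbabilityMeasure μ] {g : α → ℝ} {B : ℝ} (hB : ∀ x, |g x| ≤ B) : |∫ x, g x ∂μ| ≤ B := by
  have := norm_integral_le_of_norm_le_const (μ := μ) (f := g) (C := B) (Eventually.of_forall hB)
  simpa using this

theorem integral_exp_mem_Icc {α : Type*} [MeasurableSpace α] {μ : Measure α}
    [IsProbabilityMeasure μ] {g : α → ℝ} (hg : Measurable g) {B : ℝ} (hB : ∀ x, |g x| ≤ B) :
    ∫ x, Real.exp (g x) ∂μ ∈ Set.Icc (Real.exp (-B)) (Real.exp B) := by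
  have hi := integrable_exp_of_abs_le (μ := μ) hg hB
  constructor
  · simpa using integral_mono (μ := μ) (integrable_const (Real.exp (-B))) hi
      fun x => Real.exp_le_exp.2 (abs_le.1 (hB x)).1
  · simpa using integral_mono (μ := μ) hi (integrable_const (Real.exp B))
      fun x => Real.exp_le_exp.2 (abs_le.1 (hB x)).2

/-- Relative entropy with respect to `ν` tilted by `g` is nonnegative, and tilting changes the
integrated log-likelihood ratio by `-∫ g ∂μ + log ∫ exp g ∂ν`. -/
theorem entropyBound_klDiv {α : Type*} [MeasurableSpace α] {μ ν : Measure α}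
    [IsProbabilityMeasure μ] [IsProbabilityMeasure ν] (h : klDiv μ ν ≠ ∞) :
    EntropyBound μ ν (klDiv μ ν).toReal := by
  rintro g hg ⟨B, hB⟩
  obtain ⟨hac, hint⟩ := klDiv_ne_top_iff.1 h
  have hexp := integrable_exp_of_abs_le (μ := ν) hg hB
  have hgi := integrable_of_abs_le (μ := μ) hg hB
  have := isProbabilityMeasure_tilted hexp
  have key := integral_llr_add_sub_measure_univ_nonneg (hac.trans (absolutelyContinuous_tilted hexp))
    (integrable_llr_tilted_right hac hgi hint hexp)
  rw [integral_llr_tilted_right hac hgi hexp hint] at key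
  rw [toReal_klDiv_of_measure_eq hac (by simp)]
  simp only [probReal_univ] at key
  linarith

namespace EntropyBound

variable {α β : Type*} [MeasurableSpace α] [MeasurableSpace β]

theorem refl (μ : Measure α) [IsProbabilityMeasure μ] : EntropyBound μ μ 0 := by
  simpa using entropyBound_klDiv (μ := μ) (ν := μ) (by simp)

theorem map {μ μ' : Measure α} {C : ℝ} (h : EntropyBound μ μ' C) {f : α → β} (hf : Measurable f) :
    EntropyBound (μ.map f) (μ'.map f) C := by
  rintro g hg ⟨B, hB⟩
  rw [integral_map hf.aemeasurable hg.aestronglyMeasurable,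
    integral_map hf.aemeasurable hg.exp.aestronglyMeasurable]
  exact h _ (hg.comp hf) ⟨B, fun x => hB _⟩

/-- This is the upper half of the chain rule. The bound on the kernels, applied to each section of
`g`, leaves the log-Laplace transform `G`, which is itself an admissible test function for the base
measures. No density of the product measures is involved. -/
theorem compProd {μ μ' : Measure α} [IsProbabilityMeasure μ] [IsProbabilityMeasure μ'] {C : ℝ}
    (h : EntropyBound μ μ' C) {κ κ' : Kernel α β} [IsMarkovKernel κ] [IsMarkovKernel κ']
    {c : α → ℝ} (hc : Measurable c) {b : ℝ} (hb : ∀ x, |c x| ≤ b)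
    (hκ : ∀ x, EntropyBound (κ x) (κ' x) (c x)) :
    EntropyBound (μ.compProd κ) (μ'.compProd κ') (C + ∫ x, c x ∂μ) := by
  rintro g hg ⟨B, hB⟩
  have hgx : ∀ x, Measurable fun y => g (x, y) := fun x => hg.comp measurable_prodMk_left
  set G : α → ℝ := fun x => Real.log (∫ y, Real.exp (g (x, y)) ∂κ' x) with hG
  have hmem : ∀ x, ∫ y, Real.exp (g (x, y)) ∂κ' x ∈ Set.Icc (Real.exp (-B)) (Real.exp B) :=
    fun x => integral_exp_mem_Icc (hgx x) fun y => hB _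
  have hpos : ∀ x, 0 < ∫ y, Real.exp (g (x, y)) ∂κ' x :=
    fun x => (Real.exp_pos _).trans_le (hmem x).1
  have hGm : Measurable G :=
    (StronglyMeasurable.integral_kernel_prod_right (κ := κ')
      (f := fun x y => Real.exp (g (x, y))) hg.exp.stronglyMeasurable).measurable.log
  have hGB : ∀ x, |G x| ≤ B := fun x => abs_le.2
    ⟨(Real.le_log_iff_exp_le (hpos x)).2 (hmem x).1, (Real.log_le_iff_le_exp (hpos x)).2 (hmem x).2⟩
  rw [Measure.integral_compProd (integrable_of_abs_le hg hB),
    Measure.integral_compProd (integrable_exp_of_abs_le hg hB)]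
  have h1 : ∫ x, ∫ y, g (x, y) ∂κ x ∂μ ≤ ∫ x, (c x + G x) ∂μ := by
    refine integral_mono ?_ ((integrable_of_abs_le hc hb).add (integrable_of_abs_le hGm hGB))
      fun x => hκ x _ (hgx x) ⟨B, fun y => hB _⟩
    exact integrable_of_abs_le (StronglyMeasurable.integral_kernel_prod_right (κ := κ)
      (f := fun x y => g (x, y)) hg.stronglyMeasurable).measurable
      fun x => abs_integral_le_of_abs_le fun y => hB _
  rw [integral_add (integrable_of_abs_le hc hb) (integrable_of_abs_le hGm hGB)] at h1
  have h2 := h G hGm ⟨B, hGB⟩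
  have h3 : ∀ x, Real.exp (G x) = ∫ y, Real.exp (g (x, y)) ∂κ' x := fun x => Real.exp_log (hpos x)
  simp only [h3] at h2
  linarith

end EntropyBound

/-! ### Entropy accumulated along the interaction -/

namespace DivBandit

variable {K : ℕ} {P : Set (Fin K → ℝ)}

instance (ψ : Strategy K P) (t : ℕ) : IsMarkovKernel (ψ.act t) := ψ.markov t

theorem abs_coord_le_one (p : stdSimplex ℝ (Fin K)) (a : Fin K) : |p.1 a| ≤ 1 := by
  rw [abs_of_nonneg (p.2.1 a), ← p.2.2]
  exact Finset.single_le_sum (fun i _ => p.2.1 i) (Finset.mem_univ a)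

theorem integral_armKernel (p : stdSimplex ℝ (Fin K)) (k : Fin K → ℝ) :
    ∫ a, k a ∂(armKernel K p) = ∑ a, p.1 a * k a := by
  change ∫ a, k a ∂(∑ a, ENNReal.ofReal (p.1 a) • Measure.dirac a) = _
  rw [integral_finsetSum_measure]
  · refine Finset.sum_congr rfl fun a _ => ?_
    rw [integral_smul_measure, integral_dirac, ENNReal.toReal_ofReal (p.2.1 a), smul_eq_mul]
  · exact fun a _ => (integrable_dirac (by simp)).smul_measure ENNReal.ofReal_ne_top

/-- Conditional law of the mixed action and of the arm of a round. -/
noncomputable def pullKernel (ψ : Strategy K P) (t : ℕ) :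
    Kernel (Fin t → Round K) (stdSimplex ℝ (Fin K) × Fin K) :=
  (ψ.act t).compProd ((armKernel K).comap Prod.snd measurable_snd)

instance (ψ : Strategy K P) (t : ℕ) : IsMarkovKernel (pullKernel ψ t) := by
  unfold pullKernel; infer_instance

theorem roundKernel_apply (ψ : Strategy K P) (ν : Problem K) (t : ℕ) (h : Fin t → Round K) :
    roundKernel ψ ν t h = (pullKernel ψ t h).compProd
      ((rewardKernel ν).comap Prod.snd measurable_snd) := by
  rw [roundKernel, Kernel.compProd_apply_eq_compProd_sectR]
  rfl

theorem pullKernel_apply (ψ : Strategy K P) (t : ℕ) (h : Fin t → Round K) :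
    pullKernel ψ t h = (ψ.act t h).compProd (armKernel K) := by
  rw [pullKernel, Kernel.compProd_apply_eq_compProd_sectR]
  rfl

theorem roundKernel_map_fst (ψ : Strategy K P) (ν : Problem K) (t : ℕ) (h : Fin t → Round K) :
    (roundKernel ψ ν t h).map (fun x => x.1.1) = ψ.act t h := by
  rw [roundKernel_apply, pullKernel_apply]
  have : (fun x : Round K => x.1.1) = Prod.fst ∘ Prod.fst := rfl
  rw [this, ← Measure.map_map measurable_fst measurable_fst]
  change ((Measure.fst _)).fst = _
  rw [Measure.fst_compProd, Measure.fst_compProd]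

/-- The draws of the mixed action and of the arm are common to both problems, so only the reward
contributes; averaging its divergence over the arm gives a linear function of the mixed action. -/
theorem entropyBound_roundKernel (ψ : Strategy K P) (ν ν' : Problem K)
    (hkl : ∀ a, klDiv (ν a : Measure ℝ) (ν' a : Measure ℝ) ≠ ∞) (t : ℕ) (h : Fin t → Round K) :
    EntropyBound (roundKernel ψ ν t h) (roundKernel ψ ν' t h)
      (∫ p, ∑ a, p.1 a * (klDiv (ν a : Measure ℝ) (ν' a : Measure ℝ)).toReal ∂(ψ.act t h)) := by
  set k : Fin K → ℝ := fun a => (klDiv (ν a : Measure ℝ) (ν' a : Measure ℝ)).toReal with hk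
  have hkb : ∀ a, |k a| ≤ ∑ a, |k a| := fun a =>
    Finset.single_le_sum (f := fun a => |k a|) (fun i _ => abs_nonneg _) (Finset.mem_univ a)
  have hkm : Measurable fun x : stdSimplex ℝ (Fin K) × Fin K => k x.2 :=
    (measurable_of_countable k).comp measurable_snd
  have key := (EntropyBound.refl (pullKernel ψ t h)).compProd
    (κ := (rewardKernel ν).comap Prod.snd measurable_snd)
    (κ' := (rewardKernel ν').comap Prod.snd measurable_snd) hkm (fun x => hkb x.2)
    fun x => entropyBound_klDiv (hkl x.2)
  rw [roundKernel_apply, roundKernel_apply]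
  convert key using 1
  rw [zero_add, pullKernel_apply,
    Measure.integral_compProd (integrable_of_abs_le hkm fun x => hkb x.2)]
  simp only [integral_armKernel, hk]

theorem integral_histLaw_succ (ψ : Strategy K P) (ν : Problem K) {f : stdSimplex ℝ (Fin K) → ℝ}
    (hf : Measurable f) {B : ℝ} (hB : ∀ p, |f p| ≤ B) (T : ℕ) :
    ∫ h, ∑ t, f (h t).1.1 ∂(histLaw ψ ν (T + 1)) =
      ∫ h, ∑ t, f (h t).1.1 ∂(histLaw ψ ν T) +
        ∫ h, ∫ p, f p ∂(ψ.act T h) ∂(histLaw ψ ν T) := by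
  have hm : ∀ T, Measurable fun h : Fin T → Round K => ∑ t, f (h t).1.1 := fun T =>
    Finset.measurable_sum _ fun t _ => hf.comp
      (measurable_fst.comp (measurable_fst.comp (measurable_pi_apply t)))
  have hbd : ∀ T, ∀ h : Fin T → Round K, |∑ t, f (h t).1.1| ≤ T * B := fun T h =>
    (Finset.abs_sum_le_sum_abs _ _).trans
      ((Finset.sum_le_sum fun t _ => hB (h t).1.1).trans (by simp))
  have hp : Measurable fun x : (Fin T → Round K) × Round K => ∑ t, f (x.1 t).1.1 :=
    (hm T).comp measurable_fst
  have hr : Measurable fun x : (Fin T → Round K) × Round K => f x.2.1.1 :=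
    hf.comp (measurable_fst.comp (measurable_fst.comp measurable_snd))
  rw [show histLaw ψ ν (T + 1) = ((histLaw ψ ν T).compProd (roundKernel ψ ν T)).map
    fun x => Fin.snoc (α := fun _ => Round K) x.1 x.2 from rfl,
    integral_map (measurable_snoc K T).aemeasurable (hm _).aestronglyMeasurable]
  simp only [Fin.sum_univ_castSucc, Fin.snoc_castSucc, Fin.snoc_last]
  rw [integral_add (integrable_of_abs_le hp fun x => hbd T x.1)
    (integrable_of_abs_le hr fun x => hB x.2.1.1),
    Measure.integral_compProd (integrable_of_abs_le hp fun x => hbd T x.1),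
    Measure.integral_compProd (integrable_of_abs_le hr fun x => hB x.2.1.1)]
  congr 1
  · simp
  · refine integral_congr_ae (Eventually.of_forall fun h => ?_)
    dsimp only
    rw [← roundKernel_map_fst ψ ν T h, integral_map (by fun_prop) hf.aestronglyMeasurable]

/-- **Fundamental inequality**: the relative entropy between the laws of the first `T` rounds under
two problems is controlled by the expected cumulated divergence of the mixed actions played. -/
theorem entropyBound_histLaw (ψ : Strategy K P) (ν ν' : Problem K)
    (hkl : ∀ a, klDiv (ν a : Measure ℝ) (ν' a : Measure ℝ) ≠ ∞) (T : ℕ) :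
    EntropyBound (histLaw ψ ν T) (histLaw ψ ν' T)
      (∫ h, ∑ t, ∑ a, (h t).1.1.1 a * (klDiv (ν a : Measure ℝ) (ν' a : Measure ℝ)).toReal
        ∂(histLaw ψ ν T)) := by
  set k : Fin K → ℝ := fun a => (klDiv (ν a : Measure ℝ) (ν' a : Measure ℝ)).toReal with hk
  have hf : Measurable fun p : stdSimplex ℝ (Fin K) => ∑ a, p.1 a * k a :=
    Finset.measurable_sum _ fun a _ =>
      ((measurable_pi_apply a).comp measurable_subtype_coe).mul_const _
  have hB : ∀ p : stdSimplex ℝ (Fin K), |∑ a, p.1 a * k a| ≤ ∑ a, |k a| := fun p =>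
    (Finset.abs_sum_le_sum_abs _ _).trans (Finset.sum_le_sum fun a _ => by
      rw [abs_mul]
      exact mul_le_of_le_one_left (abs_nonneg _) (abs_coord_le_one p a))
  induction T with
  | zero => simpa [histLaw] using EntropyBound.refl (histLaw ψ ν 0)
  | succ T ih =>
    rw [integral_histLaw_succ ψ ν hf hB]
    refine EntropyBound.map (EntropyBound.compProd ih (b := ∑ a, |k a|) ?_ ?_
      fun h => entropyBound_roundKernel ψ ν ν' hkl T h) (measurable_snoc K T)
    · exact (StronglyMeasurable.integral_kernel_prod_right (κ := ψ.act T)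
        (f := fun _ p => ∑ a, p.1 a * k a) (hf.comp measurable_snd).stronglyMeasurable).measurable
    · exact fun h => abs_integral_le_of_abs_le hB

theorem ae_mem_of_histLaw (ψ : Strategy K P) (hP : MeasurableSet P) (ν : Problem K) (T : ℕ) :
    ∀ᵐ h ∂(histLaw ψ ν T), ∀ t, (h t).1.1.1 ∈ P := by
  have hm : ∀ {T} (t : Fin T), Measurable fun h : Fin T → Round K => (h t).1.1.1 := fun t =>
    measurable_subtype_coe.comp (measurable_fst.comp (measurable_fst.comp (measurable_pi_apply t)))
  induction T with
  | zero => exact Eventually.of_forall fun h t => t.elim0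
  | succ T ih =>
    have hs : MeasurableSet {h : Fin (T + 1) → Round K | ∀ t, (h t).1.1.1 ∈ P} := by
      rw [Set.ofPred_forall]
      exact MeasurableSet.iInter fun t => hm t hP
    rw [show histLaw ψ ν (T + 1) = ((histLaw ψ ν T).compProd (roundKernel ψ ν T)).map
      fun x => Fin.snoc (α := fun _ => Round K) x.1 x.2 from rfl,
      ae_map_iff (measurable_snoc K T).aemeasurable hs,
      Measure.ae_compProd_iff (p := fun x => ∀ t : Fin (T + 1),
        ((Fin.snoc (α := fun _ => Round K) x.1 x.2 : Fin (T + 1) → Round K) t).1.1.1 ∈ P)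
        (measurable_snoc K T hs)]
    filter_upwards [ih] with h hh
    have h1 := ψ.mem T h
    rw [← roundKernel_map_fst ψ ν T h, ae_map_iff (by fun_prop) (measurable_subtype_coe hP)] at h1
    filter_upwards [h1] with x hx t
    refine Fin.lastCases ?_ (fun j => ?_) t
    · simpa using hx
    · simpa using hh j

/-! ### Gaps and regret -/

theorem continuous_payoff (ν : Problem K) : Continuous (payoff ν) := by
  unfold payoff; fun_prop

theorem continuous_gap (P : Set (Fin K → ℝ)) (ν : Problem K) : Continuous (gap P ν) :=
  continuous_const.sub (continuous_payoff ν)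

theorem gap_nonneg (hP : IsCompact P) (ν : Problem K) {p : Fin K → ℝ} (hp : p ∈ P) :
    0 ≤ gap P ν p :=
  sub_nonneg.2 (le_csSup (hP.image (continuous_payoff ν)).bddAbove (Set.mem_image_of_mem _ hp))

theorem gap_eq_zero_iff (hP : IsCompact P) (ν : Problem K) {p : Fin K → ℝ} (hp : p ∈ P) :
    gap P ν p = 0 ↔ p ∈ Opt P ν := by
  constructor
  · refine fun h => ⟨hp, fun q hq => ?_⟩
    have := gap_nonneg hP ν hq
    simp only [gap] at h this
    linarith
  · intro h
    have : IsGreatest (payoff ν '' P) (payoff ν p) :=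
      ⟨Set.mem_image_of_mem _ hp, by rintro _ ⟨q, hq, rfl⟩; exact h.2 q hq⟩
    rw [gap, maxPayoff, this.csSup_eq, sub_self]

/-- If the unique optimal mixed action of `ν` is not optimal for `ν'`, no mixed action is close to
optimal in both problems. -/
theorem exists_pos_le_gap_add_gap (hP : IsCompact P) {ν ν' : Problem K} {pstar : Fin K → ℝ}
    (hopt : Opt P ν = {pstar}) (hν' : pstar ∉ Opt P ν') :
    ∃ m, 0 < m ∧ ∀ p ∈ P, m ≤ gap P ν p + gap P ν' p := by
  have hps : pstar ∈ P := (hopt.symm ▸ Set.mem_singleton pstar : pstar ∈ Opt P ν).1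
  -- By compactness the sum of the gaps attains its minimum; a zero minimum would make `q` optimal
  -- in both problems, hence equal to `pstar`.
  obtain ⟨q, hq, hmin⟩ := hP.exists_isMinOn ⟨pstar, hps⟩
    ((continuous_gap P ν).add (continuous_gap P ν')).continuousOn
  refine ⟨gap P ν q + gap P ν' q, ?_, fun p hp => hmin hp⟩
  have h1 := gap_nonneg hP ν hq
  have h2 := gap_nonneg hP ν' hq
  refine (add_nonneg h1 h2).lt_of_ne fun h => hν' ?_
  have h3 : q ∈ Opt P ν := (gap_eq_zero_iff hP ν hq).1 (by linarith)
  rw [hopt, Set.mem_singleton_iff] at h3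
  exact h3 ▸ (gap_eq_zero_iff hP ν' hq).1 (by linarith)

theorem measurable_sum_action {f : (Fin K → ℝ) → ℝ} (hf : Measurable f) (T : ℕ) :
    Measurable fun h : Fin T → Round K => ∑ t, f (h t).1.1.1 :=
  Finset.measurable_sum _ fun t _ => hf.comp (measurable_subtype_coe.comp
    (measurable_fst.comp (measurable_fst.comp (measurable_pi_apply t))))

theorem integrable_sum_action {f : (Fin K → ℝ) → ℝ} (hf : Continuous f) {T : ℕ}
    (μ : Measure (Fin T → Round K)) [IsFiniteMeasure μ] :
    Integrable (fun h : Fin T → Round K => ∑ t, f (h t).1.1.1) μ := by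
  obtain ⟨B, hB⟩ := (isCompact_stdSimplex ℝ (Fin K)).exists_bound_of_continuousOn hf.continuousOn
  refine integrable_of_abs_le (B := T * B) (measurable_sum_action hf.measurable T) fun h => ?_
  exact (Finset.abs_sum_le_sum_abs _ _).trans
      ((Finset.sum_le_sum fun t _ => hB _ (h t).1.1.2).trans (by simp))

theorem regret_eq_integral_gap (ψ : Strategy K P) (ν : Problem K) (T : ℕ) :
    regret ψ ν T = ∫ h, ∑ t, gap P ν (h t).1.1.1 ∂(histLaw ψ ν T) := by
  simp only [gap, Finset.sum_sub_distrib]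
  rw [integral_sub (by fun_prop) (integrable_sum_action (continuous_payoff ν) _)]
  simp [regret]

theorem regret_nonneg (hP : IsCompact P) (ψ : Strategy K P) (ν : Problem K) (T : ℕ) :
    0 ≤ regret ψ ν T := by
  rw [regret_eq_integral_gap]
  refine integral_nonneg_of_ae ?_
  filter_upwards [ae_mem_of_histLaw ψ hP.measurableSet ν T] with h hh
  exact Finset.sum_nonneg fun t _ => gap_nonneg hP ν (hh t)

/-! ### The change-of-measure inequality -/

/-- The exponential lies below its chord. This turns an exponential moment of the test statistic
into its mean, which the regret controls. -/
theorem exp_mul_le_one_add {l z : ℝ} (h0 : 0 ≤ z) (h1 : z ≤ 1) :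
    Real.exp (l * z) ≤ 1 + Real.exp l * z := by
  have := convexOn_exp.2 (Set.mem_univ 0) (Set.mem_univ l) (sub_nonneg.2 h1) h0 (by ring)
  simp only [smul_eq_mul, mul_zero, zero_add, Real.exp_zero, mul_one] at this
  rw [mul_comm z l] at this
  linarith

/-- A strategy with small regret on both `ν` and the confusing problem `ν'` has to gather
information at a rate quantified by the expected cumulated divergence. -/
theorem mul_one_sub_regret_le (hP : IsCompact P) (ψ : Strategy K P) (ν ν' : Problem K)
    (hkl : ∀ a, klDiv (ν a : Measure ℝ) (ν' a : Measure ℝ) ≠ ∞)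
    {m : ℝ} (hm : 0 < m) (hsep : ∀ p ∈ P, m ≤ gap P ν p + gap P ν' p)
    {T : ℕ} (hT : 0 < T) {l : ℝ} (hl : 0 ≤ l) :
    l * (1 - regret ψ ν T / (m * T)) ≤
      ∫ h, ∑ t, ∑ a, (h t).1.1.1 a * (klDiv (ν a : Measure ℝ) (ν' a : Measure ℝ)).toReal
        ∂(histLaw ψ ν T) + Real.log (1 + Real.exp l * (regret ψ ν' T / (m * T))) := by
  have hT' : (0 : ℝ) < T := Nat.cast_pos.2 hT
  -- The gap in `ν'`, scaled by `m` and clipped to `[0, 1]`. On `P` it satisfies `f ≤ gap P ν' / m`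
  -- and, by separation, `1 - f ≤ gap P ν / m`. Its time average `Z` thus has mean near 1 under `ν`
  -- and near 0 under `ν'` when both regrets are small.
  set f : (Fin K → ℝ) → ℝ := fun p => max 0 (min 1 (gap P ν' p / m)) with hf
  have hfc : Continuous f := continuous_const.max
    (continuous_const.min ((continuous_gap P ν').div_const m))
  have hf0 : ∀ p, 0 ≤ f p := fun p => le_max_left _ _
  have hf1 : ∀ p, f p ≤ 1 := fun p => max_le zero_le_one (min_le_left _ _)
  set Z : (Fin T → Round K) → ℝ := fun h => (∑ t, f (h t).1.1.1) / T with hZ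
  have hZm : Measurable Z := (measurable_sum_action hfc.measurable T).div_const _
  have hZ0 : ∀ h, 0 ≤ Z h := fun h => div_nonneg (Finset.sum_nonneg fun t _ => hf0 _) hT'.le
  have hZ1 : ∀ h, Z h ≤ 1 := fun h => (div_le_one hT').2
    ((Finset.sum_le_sum fun t _ => hf1 _).trans (by simp))
  have hZb : ∀ h, |Z h| ≤ 1 := fun h => by rw [abs_of_nonneg (hZ0 h)]; exact hZ1 h
  have hgb : ∀ h, |l * Z h| ≤ l := fun h => by
    rw [abs_mul, abs_of_nonneg hl]; exact mul_le_of_le_one_right hl (hZb h)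
  have hgm : Measurable fun h => l * Z h := hZm.const_mul l
  have key := entropyBound_histLaw ψ ν ν' hkl T _ hgm ⟨l, hgb⟩
  have hint : ∀ ν₀ : Problem K, Integrable Z (histLaw ψ ν₀ T) := fun ν₀ =>
    integrable_of_abs_le hZm hZb
  have hR : ∀ ν₀ : Problem K, regret ψ ν₀ T / (m * T) =
      ∫ h, (∑ t, gap P ν₀ (h t).1.1.1) / (m * T) ∂(histLaw ψ ν₀ T) := fun ν₀ => by
    rw [regret_eq_integral_gap, integral_div]
  have hgi : ∀ ν₀ : Problem K, Integrable
      (fun h : Fin T → Round K => (∑ t, gap P ν₀ (h t).1.1.1) / (m * T)) (histLaw ψ ν₀ T) :=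
    fun ν₀ => (integrable_sum_action (continuous_gap P ν₀) _).div_const _
  have hlow : 1 - regret ψ ν T / (m * T) ≤ ∫ h, Z h ∂(histLaw ψ ν T) := by
    rw [sub_le_comm, hR]
    have : 1 - ∫ h, Z h ∂(histLaw ψ ν T) = ∫ h, (1 - Z h) ∂(histLaw ψ ν T) := by
      rw [integral_sub (integrable_const _) (hint ν)]; simp
    rw [this]
    refine integral_mono_ae ((integrable_const _).sub (hint ν)) (hgi ν) ?_
    filter_upwards [ae_mem_of_histLaw ψ hP.measurableSet ν T] with h hh
    have : 1 - Z h = (∑ t, (1 - f (h t).1.1.1)) / T := by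
      simp only [hZ, Finset.sum_sub_distrib]
      field_simp
      simp
    rw [this, ← div_div, Finset.sum_div Finset.univ _ m]
    refine div_le_div_of_nonneg_right (Finset.sum_le_sum fun t _ => ?_) hT'.le
    have h1 := hsep _ (hh t)
    have h2 := gap_nonneg hP ν (hh t)
    rw [sub_le_comm, hf]
    refine le_max_of_le_right (le_min (by linarith [div_nonneg h2 hm.le]) ?_)
    rw [sub_le_iff_le_add, ← add_div, one_le_div hm]
    linarith
  have hup : ∫ h, Z h ∂(histLaw ψ ν' T) ≤ regret ψ ν' T / (m * T) := by
    rw [hR]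
    refine integral_mono_ae (hint ν') (hgi ν') ?_
    filter_upwards [ae_mem_of_histLaw ψ hP.measurableSet ν' T] with h hh
    rw [← div_div, Finset.sum_div Finset.univ _ m]
    refine div_le_div_of_nonneg_right (Finset.sum_le_sum fun t _ => ?_) hT'.le
    exact max_le (div_nonneg (gap_nonneg hP ν' (hh t)) hm.le) (min_le_right _ _)
  have hexp : ∫ h, Real.exp (l * Z h) ∂(histLaw ψ ν' T) ≤
      1 + Real.exp l * (regret ψ ν' T / (m * T)) := by
    calc ∫ h, Real.exp (l * Z h) ∂(histLaw ψ ν' T)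
        ≤ ∫ h, (1 + Real.exp l * Z h) ∂(histLaw ψ ν' T) :=
          integral_mono (integrable_exp_of_abs_le hgm hgb)
            ((integrable_const _).add ((hint ν').const_mul _))
            fun h => exp_mul_le_one_add (hZ0 h) (hZ1 h)
      _ = 1 + Real.exp l * ∫ h, Z h ∂(histLaw ψ ν' T) := by
          rw [integral_add (integrable_const _) ((hint ν').const_mul _), integral_const_mul]
          simp
      _ ≤ _ := by gcongr
  have hpos := (Real.exp_pos _).trans_le (integral_exp_mem_Icc (μ := histLaw ψ ν' T) hgm hgb).1
  have := Real.log_le_log hpos hexp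
  rw [integral_const_mul] at key
  have := mul_le_mul_of_nonneg_left hlow hl
  linarith

/-! ### Allocations and their limit points -/

/-- The expected sum of the mixed actions played is a nonnegative combination, of total weight `T`,
of the points generating the polytope. -/
theorem exists_weights {E : Finset (Fin K → ℝ)} (hP : P = convexHull ℝ (E : Set (Fin K → ℝ)))
    (ψ : Strategy K P) (ν : Problem K) (T : ℕ) :
    ∃ w : (Fin K → ℝ) → ℝ, (∀ e ∈ E, 0 ≤ w e) ∧ ∑ e ∈ E, w e = T ∧ ∀ k : Fin K → ℝ,
      ∫ h, ∑ t, ∑ a, (h t).1.1.1 a * k a ∂(histLaw ψ ν T) = ∑ e ∈ E, w e * ∑ a, e a * k a := by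
  have hcomp : IsCompact P := hP ▸ E.finite_toSet.isCompact_convexHull ℝ
  have hconv : Convex ℝ P := hP ▸ convex_convexHull ℝ _
  rcases Nat.eq_zero_or_pos T with rfl | hT
  · exact ⟨0, by simp, by simp, by simp⟩
  have hT' : (0 : ℝ) < T := Nat.cast_pos.2 hT
  set x : (Fin T → Round K) → Fin K → ℝ := fun h a => (∑ t, (h t).1.1.1 a) / T with hx
  have hxi : ∀ a, Integrable (fun h => x h a) (histLaw ψ ν T) := fun a =>
    (integrable_sum_action (continuous_apply a) _).div_const _
  -- Only the expected average action is decomposed over `E`, so no measurable decomposition of the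
  -- random actions is needed.
  have hxP : ∫ h, x h ∂(histLaw ψ ν T) ∈ P := by
    refine hconv.integral_mem hcomp.isClosed ?_ (Integrable.of_eval hxi)
    filter_upwards [ae_mem_of_histLaw ψ hcomp.measurableSet ν T] with h hh
    have := hconv.sum_mem (t := Finset.univ) (w := fun _ : Fin T => (T : ℝ)⁻¹)
      (fun _ _ => by positivity) (by simp [hT'.ne']) fun t _ => hh t
    convert this using 1
    ext a
    simp [hx, div_eq_inv_mul, Finset.mul_sum]
  obtain ⟨w, hw0, hw1, hwx⟩ := Finset.mem_convexHull'.1 (hP.subset hxP)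
  refine ⟨fun e => T * w e, fun e he => mul_nonneg hT'.le (hw0 e he), ?_, fun k => ?_⟩
  · rw [← Finset.mul_sum, hw1, mul_one]
  have hxa : ∀ a, ∫ h, x h a ∂(histLaw ψ ν T) = ∑ e ∈ E, w e * e a := fun a => by
    rw [← eval_integral hxi, ← hwx]
    simp
  have h1 : ∀ h : Fin T → Round K, ∑ t, ∑ a, (h t).1.1.1 a * k a = ∑ a, T * k a * x h a := by
    intro h
    rw [Finset.sum_comm]
    refine Finset.sum_congr rfl fun a _ => ?_
    rw [← Finset.sum_mul, hx]
    field_simp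
  simp only [h1]
  rw [integral_finsetSum _ fun a _ => (hxi a).const_mul _]
  simp only [integral_const_mul, hxa, Finset.mul_sum]
  rw [Finset.sum_comm]
  exact Finset.sum_congr rfl fun e _ => Finset.sum_congr rfl fun a _ => by ring

theorem tendsto_log_natCast_atTop : Tendsto (fun T : ℕ => Real.log T) atTop atTop :=
  Real.tendsto_log_atTop.comp tendsto_natCast_atTop_atTop

/-- If the regret on `ν` is frequently below `r * log T`, the normalized expected allocations have a
limit point that satisfies the information constraints and costs at most `r`. -/
theorem exists_allocation {E : Finset (Fin K → ℝ)}
    (hE : ∀ p ∈ E, p ∈ stdSimplex ℝ (Fin K)) (hP : P = convexHull ℝ (E : Set (Fin K → ℝ)))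
    {D : Set (ProbabilityMeasure ℝ)} {ν : Problem K} (hν : InModel D ν) {pstar : Fin K → ℝ}
    (hpstar : Opt P ν = {pstar}) {ψ : Strategy K P} (hψ : IsUFC D ψ) {r : ℝ}
    (hr : ∃ᶠ T : ℕ in atTop, regret ψ ν T / Real.log T < r) :
    ∃ n : E → ℝ, (∀ e, 0 ≤ n e) ∧ (∀ e, e.1 = pstar → n e = 0) ∧
      ∑ e, n e * gap P ν e.1 ≤ r ∧
      ∀ ν' ∈ Conf P D ν pstar, (∀ a, klDiv (ν a : Measure ℝ) (ν' a : Measure ℝ) ≠ ∞) →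
        1 ≤ ∑ e, n e * ∑ a, e.1 a * (klDiv (ν a : Measure ℝ) (ν' a : Measure ℝ)).toReal := by
  classical
  have hcomp : IsCompact P := hP ▸ E.finite_toSet.isCompact_convexHull ℝ
  have hEP : ∀ e ∈ E, e ∈ P := fun e he => hP ▸ subset_convexHull ℝ _ he
  have hps : pstar ∈ Opt P ν := hpstar ▸ Set.mem_singleton pstar
  have hgap0 : gap P ν pstar = 0 := (gap_eq_zero_iff hcomp ν hps.1).2 hps
  have hgap : ∀ e ∈ E, e ≠ pstar → 0 < gap P ν e := fun e he hne =>
    (gap_nonneg hcomp ν (hEP e he)).lt_of_ne fun h => hne <| by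
      simpa [hpstar] using (gap_eq_zero_iff hcomp ν (hEP e he)).1 h.symm
  choose w hw0 hwT hw using exists_weights hP ψ ν
  have hreg : ∀ T, regret ψ ν T = ∑ e ∈ E, w T e * gap P ν e := fun T => by
    simp only [gap, mul_sub, Finset.sum_sub_distrib]
    rw [← Finset.sum_mul, hwT]
    simp only [payoff]
    rw [← hw T fun a => mean (ν a)]
    rfl
  -- The weight of `pstar` may be of order `T`, hence unbounded after division by `log T`.
  -- Discarding it is harmless, as `pstar` has neither gap nor divergence (`hgap0`, `hk0`).
  set v : ℕ → E → ℝ := fun T e => if e.1 = pstar then 0 else w T e.1 / Real.log T with hv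
  have hvsum : ∀ (T : ℕ) (c : (Fin K → ℝ) → ℝ), c pstar = 0 →
      ∑ e, v T e * c e.1 = (∑ e ∈ E, w T e * c e) / Real.log T := fun T c hc => by
    rw [Finset.sum_div, ← Finset.sum_coe_sort E fun e => w T e * c e / Real.log T]
    refine Finset.sum_congr rfl fun e _ => ?_
    by_cases he : e.1 = pstar
    · simp [he, hc]
    · simp only [hv, if_neg he]; ring
  set S : Set ℕ := {T | regret ψ ν T / Real.log T < r} with hS
  have : (atTop ⊓ 𝓟 S).NeBot := frequently_mem_iff_neBot.1 hr
  -- The limit is taken along an ultrafilter fixed before any alternative is chosen, so one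
  -- allocation serves all `ν'`.
  set U : Ultrafilter ℕ := Ultrafilter.of (atTop ⊓ 𝓟 S)
  have hUtop : (U : Filter ℕ) ≤ atTop := (Ultrafilter.of_le _).trans inf_le_left
  have hUS : ∀ᶠ T in (U : Filter ℕ), regret ψ ν T / Real.log T < r :=
    (Ultrafilter.of_le _).trans inf_le_right (mem_principal_self S)
  have hU1 : ∀ᶠ T in (U : Filter ℕ), 1 < T := hUtop (eventually_gt_atTop 1)
  -- Each term of the regret is at most the whole, which is below `r * log T` along `U`.
  set b : E → ℝ := fun e => if e.1 = pstar then 0 else r / gap P ν e.1 with hb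
  have hvb : ∀ᶠ T in (U : Filter ℕ), v T ∈ Set.Icc 0 b := by
    filter_upwards [hUS, hU1] with T hT hT1
    have hlog : 0 < Real.log T := Real.log_pos (by exact_mod_cast hT1)
    refine ⟨fun e => ?_, fun e => ?_⟩
    · by_cases he : e.1 = pstar
      · simp [hv, he]
      · simpa [hv, he] using div_nonneg (hw0 T _ e.2) hlog.le
    · by_cases he : e.1 = pstar
      · simp [hv, hb, he]
      · simp only [hv, hb, if_neg he]
        rw [le_div_iff₀ (hgap _ e.2 he), div_mul_eq_mul_div]
        refine le_trans ?_ hT.le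
        rw [hreg]
        refine div_le_div_of_nonneg_right ?_ hlog.le
        exact Finset.single_le_sum (f := fun e => w T e * gap P ν e)
          (fun i hi => mul_nonneg (hw0 T i hi) (gap_nonneg hcomp ν (hEP i hi))) e.2
  obtain ⟨n, hn, hlim⟩ := (isCompact_Icc (a := (0 : E → ℝ)) (b := b)).ultrafilter_le_nhds
    (U.map v) (le_principal_iff.2 hvb)
  have hlim' : Tendsto v U (𝓝 n) := hlim
  have hsumlim : ∀ c : (Fin K → ℝ) → ℝ,
      Tendsto (fun T => ∑ e, v T e * c e.1) U (𝓝 (∑ e, n e * c e.1)) := fun c =>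
    tendsto_finsetSum _ fun e _ => ((tendsto_pi_nhds.1 hlim') e).mul_const _
  refine ⟨n, hn.1, fun e he => le_antisymm (by simpa [hb, he] using hn.2 e) (hn.1 e), ?_, ?_⟩
  · refine le_of_tendsto (hsumlim (gap P ν)) ?_
    filter_upwards [hUS] with T hT
    rw [hvsum T _ hgap0, ← hreg]
    exact hT.le
  · intro ν' hν' hkl
    obtain ⟨m, hm, hsep⟩ := exists_pos_le_gap_add_gap hcomp hpstar hν'.2.1
    set k : Fin K → ℝ := fun a => (klDiv (ν a : Measure ℝ) (ν' a : Measure ℝ)).toReal with hk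
    have hk0 : ∑ a, pstar a * k a = 0 := Finset.sum_eq_zero fun a _ => by
      rcases hν'.2.2 a with h | h
      · simp [h]
      · simp [hk, h]
    refine le_of_forall_pos_sub_le fun ε hε => ?_
    rcases le_or_gt 1 ε with h1 | h1
    · refine (sub_nonpos.2 h1).trans (Finset.sum_nonneg fun e _ => mul_nonneg (hn.1 e) ?_)
      exact Finset.sum_nonneg fun a _ => mul_nonneg ((hE e.1 e.2).1 a) ENNReal.toReal_nonneg
    have hR : Tendsto (fun T : ℕ => regret ψ ν T / (m * T)) atTop (𝓝 0) := by
      have := (hψ ν hν 1 one_pos).tendsto_div_nhds_zero.div_const m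
      simpa [div_div, mul_comm] using this
    have hR' : Tendsto (fun T : ℕ => regret ψ ν' T / (m * (T : ℝ) ^ ε)) atTop (𝓝 0) := by
      have := (hψ ν' hν'.1 ε hε).tendsto_div_nhds_zero.div_const m
      simpa [div_div, mul_comm] using this
    have hl : Tendsto (fun T : ℕ => Real.log (1 + regret ψ ν' T / (m * (T : ℝ) ^ ε)) /
        Real.log T) atTop (𝓝 0) := by
      have h2 : Tendsto (fun T : ℕ => Real.log (1 + regret ψ ν' T / (m * (T : ℝ) ^ ε))) atTop
          (𝓝 (Real.log (1 + 0))) :=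
        (Real.continuousAt_log (by norm_num)).tendsto.comp (tendsto_const_nhds.add hR')
      exact h2.div_atTop tendsto_log_natCast_atTop
    have hL : Tendsto (fun T : ℕ => (1 - ε) * (1 - regret ψ ν T / (m * T))) U (𝓝 (1 - ε)) := by
      simpa using (((tendsto_const_nhds (x := (1 : ℝ))).sub hR).const_mul (1 - ε)).mono_left hUtop
    have hRl := (hsumlim fun e => ∑ a, e a * k a).add (hl.mono_left hUtop)
    rw [add_zero] at hRl
    refine le_of_tendsto_of_tendsto hL hRl ?_
    filter_upwards [hU1] with T hT1
    have hT0 : (0 : ℝ) < T := by exact_mod_cast zero_lt_one.trans hT1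
    have hlog : 0 < Real.log T := Real.log_pos (by exact_mod_cast hT1)
    -- With this `l`, the factor `exp l / T` equals `T ^ (-ε)`, which the UFC property under `ν'`
    -- beats: the logarithmic error term stays bounded. The case `1 ≤ ε` was set aside so that `l`
    -- is nonnegative.
    have key := mul_one_sub_regret_le hcomp ψ ν ν' hkl hm hsep (zero_lt_one.trans hT1)
      (l := (1 - ε) * Real.log T) (mul_nonneg (by linarith) hlog.le)
    have hexp : Real.exp ((1 - ε) * Real.log T) * (regret ψ ν' T / (m * T)) =
        regret ψ ν' T / (m * (T : ℝ) ^ ε) := by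
      rw [mul_comm (1 - ε), ← Real.rpow_def_of_pos hT0, Real.rpow_sub hT0, Real.rpow_one]
      have := (Real.rpow_pos_of_pos hT0 ε).ne'
      field_simp
    rw [hexp, hw] at key
    rw [hvsum T (fun e => ∑ a, e a * k a) hk0, ← add_div, le_div_iff₀ hlog]
    linarith

/-! ### From limit allocations to the constrained infimum -/

/-- Increasing slightly an allocation satisfying the constraints given by the alternatives at finite
divergence makes it satisfy all constraints. -/
theorem feasible_add {E : Finset (Fin K → ℝ)} (hE : ∀ p ∈ E, p ∈ stdSimplex ℝ (Fin K))
    (hcharge : ∀ a : Fin K, ∃ p ∈ E, 0 < p a)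
    {D : Set (ProbabilityMeasure ℝ)} {ν : Problem K} {pstar : Fin K → ℝ} {n : E → ℝ}
    (hn : ∀ e, 0 ≤ n e) (hn0 : ∀ e, e.1 = pstar → n e = 0)
    (hcons : ∀ ν' ∈ Conf P D ν pstar, (∀ a, klDiv (ν a : Measure ℝ) (ν' a : Measure ℝ) ≠ ∞) →
        1 ≤ ∑ e, n e * ∑ a, e.1 a * (klDiv (ν a : Measure ℝ) (ν' a : Measure ℝ)).toReal)
    {ε : ℝ} (hε : 0 < ε) :
    Feasible P E D ν pstar fun e => (n e + ε).toNNReal := by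
  classical
  intro ν' hν'
  have hpos : ∀ e, 0 < n e + ε := fun e => add_pos_of_nonneg_of_pos (hn e) hε
  by_cases hkl : ∀ a, klDiv (ν a : Measure ℝ) (ν' a : Measure ℝ) ≠ ∞
  · have h1 := ENNReal.ofReal_le_ofReal (hcons ν' hν' hkl)
    rw [ENNReal.ofReal_one, ENNReal.ofReal_sum_of_nonneg fun e _ => mul_nonneg (hn e)
      (Finset.sum_nonneg fun a _ => mul_nonneg ((hE e.1 e.2).1 a) ENNReal.toReal_nonneg)] at h1
    refine h1.trans ?_
    rw [← Finset.sum_filter_of_ne (p := fun e : E => e.1 ≠ pstar)]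
    · refine Finset.sum_le_sum fun e _ => ?_
      rw [ENNReal.ofReal_mul (hn e), ENNReal.ofReal_sum_of_nonneg fun a _ =>
        mul_nonneg ((hE e.1 e.2).1 a) ENNReal.toReal_nonneg]
      refine mul_le_mul' (ENNReal.ofReal_le_ofReal (by linarith)) ?_
      rw [← Finset.sum_filter_of_ne (p := fun a => pstar a = 0)]
      · refine Finset.sum_le_sum fun a _ => ?_
        rw [ENNReal.ofReal_mul ((hE e.1 e.2).1 a), ENNReal.ofReal_toReal (hkl a)]
      · intro a _ ha
        refine (hν'.2.2 a).resolve_right fun h => ha ?_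
        simp [h]
    · intro e _ he h
      simp [hn0 e h] at he
  · push Not at hkl
    obtain ⟨a, ha⟩ := hkl
    -- An arm of infinite divergence is not charged by `pstar`, but some other point of `E` charges
    -- it. Its weight is now positive, so the convention `0 * ∞ = 0` does not apply and the sum is
    -- infinite.
    have hpa : pstar a = 0 := (hν'.2.2 a).resolve_right fun h => by
      rw [h, klDiv_self] at ha
      exact ENNReal.zero_ne_top ha
    obtain ⟨p, hp, hppos⟩ := hcharge a
    have hne : p ≠ pstar := by
      rintro rfl
      exact hppos.ne' hpa
    refine le_top.trans (le_of_eq_of_le ?_ (Finset.single_le_sum (fun _ _ => zero_le)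
      (Finset.mem_filter.2 ⟨Finset.mem_univ (⟨p, hp⟩ : E), hne⟩)))
    refine (ENNReal.mul_eq_top.2 (Or.inl ⟨?_, ?_⟩)).symm
    · simpa using hpos ⟨p, hp⟩
    · refine top_le_iff.1 (le_of_eq_of_le ?_ (Finset.single_le_sum (fun _ _ => zero_le)
        (Finset.mem_filter.2 ⟨Finset.mem_univ a, hpa⟩)))
      rw [ha, ENNReal.mul_top (by simpa using hppos)]

/-- The extra cost of the increase by `ε` vanishes as `ε` decreases to 0. -/
theorem lowerConst_le_of_allocation {E : Finset (Fin K → ℝ)}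
    (hE : ∀ p ∈ E, p ∈ stdSimplex ℝ (Fin K)) (hP : P = convexHull ℝ (E : Set (Fin K → ℝ)))
    (hcharge : ∀ a : Fin K, ∃ p ∈ E, 0 < p a)
    {D : Set (ProbabilityMeasure ℝ)} {ν : Problem K} {pstar : Fin K → ℝ} {n : E → ℝ}
    (hn : ∀ e, 0 ≤ n e) (hn0 : ∀ e, e.1 = pstar → n e = 0)
    (hcons : ∀ ν' ∈ Conf P D ν pstar, (∀ a, klDiv (ν a : Measure ℝ) (ν' a : Measure ℝ) ≠ ∞) →
        1 ≤ ∑ e, n e * ∑ a, e.1 a * (klDiv (ν a : Measure ℝ) (ν' a : Measure ℝ)).toReal) :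
    lowerConst P E D ν pstar ≤ ENNReal.ofReal (∑ e, n e * gap P ν e.1) := by
  have hcomp : IsCompact P := hP ▸ E.finite_toSet.isCompact_convexHull ℝ
  have hg : ∀ e : E, 0 ≤ gap P ν e.1 := fun e =>
    gap_nonneg hcomp ν (hP ▸ subset_convexHull ℝ _ e.2)
  have hlim : Tendsto (fun ε : ℝ => ENNReal.ofReal (∑ e, (n e + ε) * gap P ν e.1)) (𝓝[>] 0)
      (𝓝 (ENNReal.ofReal (∑ e, n e * gap P ν e.1))) := by
    have hc : Continuous fun ε : ℝ => ENNReal.ofReal (∑ e, (n e + ε) * gap P ν e.1) :=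
      ENNReal.continuous_ofReal.comp (by fun_prop)
    have := hc.tendsto 0
    simp only [add_zero] at this
    exact this.mono_left nhdsWithin_le_nhds
  refine ge_of_tendsto hlim ?_
  filter_upwards [self_mem_nhdsWithin] with ε hε
  refine (iInf₂_le _ (feasible_add hE hcharge hn hn0 hcons hε)).trans_eq ?_
  have hnn : ∀ e, 0 ≤ n e + ε := fun e => add_nonneg (hn e) (le_of_lt hε)
  rw [ENNReal.ofReal_sum_of_nonneg fun e _ => mul_nonneg (hnn e) (hg e)]
  refine Finset.sum_congr rfl fun e _ => ?_
  rw [ENNReal.ofReal_mul (hnn e), mul_comm]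
  rfl

theorem lowerConst_le_liminf {E : Finset (Fin K → ℝ)}
    (hE : ∀ p ∈ E, p ∈ stdSimplex ℝ (Fin K)) (hP : P = convexHull ℝ (E : Set (Fin K → ℝ)))
    (hcharge : ∀ a : Fin K, ∃ p ∈ E, 0 < p a)
    {D : Set (ProbabilityMeasure ℝ)} {ν : Problem K} (hν : InModel D ν) {pstar : Fin K → ℝ}
    (hpstar : Opt P ν = {pstar}) {ψ : Strategy K P} (hψ : IsUFC D ψ) :
    (lowerConst P E D ν pstar : EReal) ≤
      liminf (fun T : ℕ => ((regret ψ ν T / Real.log T : ℝ) : EReal)) atTop := by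
  have hcomp : IsCompact P := hP ▸ E.finite_toSet.isCompact_convexHull ℝ
  by_contra! hlt
  obtain ⟨r, hr1, hr2⟩ := EReal.lt_iff_exists_real_btwn.1 hlt
  have hfreq : ∃ᶠ T : ℕ in atTop, regret ψ ν T / Real.log T < r := by
    simpa using frequently_lt_of_liminf_lt (by isBoundedDefault) hr1
  -- Nonnegativity of `r` ensures that `ENNReal.ofReal r` is not truncated.
  have hr0 : 0 ≤ r := by
    obtain ⟨T, hT⟩ := hfreq.exists
    exact (div_nonneg (regret_nonneg hcomp ψ ν T) (Real.log_natCast_nonneg T)).trans hT.le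
  obtain ⟨n, hn, hn0, hcost, hcons⟩ := exists_allocation hE hP hν hpstar hψ hfreq
  have hle := (lowerConst_le_of_allocation hE hP hcharge hn hn0 hcons).trans
    (ENNReal.ofReal_le_ofReal hcost)
  rw [← EReal.coe_ennreal_le_coe_ennreal_iff, EReal.coe_ennreal_ofReal, max_eq_left hr0] at hle
  exact absurd hr2 hle.not_gt

/-! ### When the constrained infimum is zero or positive -/

theorem lowerConst_eq_zero {E : Finset (Fin K → ℝ)} {D : Set (ProbabilityMeasure ℝ)}
    {ν : Problem K} {pstar : Fin K → ℝ} (hpstar : Opt P ν = {pstar}) (hpos : ∀ a, 0 < pstar a) :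
    lowerConst P E D ν pstar = 0 := by
  have hfeas : Feasible P E D ν pstar 0 := by
    rintro ν' ⟨-, hopt, heq⟩
    have : ν = ν' := funext fun a => (heq a).resolve_left (hpos a).ne'
    exact absurd (hpstar ▸ Set.mem_singleton pstar) (this ▸ hopt)
  exact le_antisymm ((iInf₂_le _ hfeas).trans (by simp)) zero_le

/-- If the means of the model are unbounded and `pstar` does not charge all arms, there exist
confusing alternative problems. -/
theorem conf_nonempty {E : Finset (Fin K → ℝ)}
    (hP : P = convexHull ℝ (E : Set (Fin K → ℝ)))
    (hcharge : ∀ a : Fin K, ∃ p ∈ E, 0 < p a)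
    {D : Set (ProbabilityMeasure ℝ)} {ν : Problem K} (hν : InModel D ν) {pstar : Fin K → ℝ}
    (hD : ¬ BddAbove (mean '' D)) {a : Fin K} (ha : pstar a = 0) :
    (Conf P D ν pstar).Nonempty := by
  classical
  obtain ⟨p, hp, hpa⟩ := hcharge a
  -- Above this threshold, giving arm `a` the distribution `ρ` lifts the payoff of `p` past that of
  -- `pstar`, which is unchanged.
  obtain ⟨_, ⟨ρ, hρ, rfl⟩, hlt⟩ := not_bddAbove_iff.1 hD
    ((payoff ν pstar - payoff ν p) / p a + mean (ν a))
  have hpay : ∀ q : Fin K → ℝ, payoff (Function.update ν a ρ) q =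
      payoff ν q + q a * (mean ρ - mean (ν a)) := fun q => by
    simp only [payoff]
    rw [← Finset.add_sum_erase _ _ (Finset.mem_univ a),
      ← Finset.add_sum_erase Finset.univ (fun a => q a * mean (ν a)) (Finset.mem_univ a),
      Finset.sum_congr rfl fun i hi => by rw [Function.update_of_ne (Finset.ne_of_mem_erase hi)]]
    rw [Function.update_self]
    ring
  refine ⟨Function.update ν a ρ, fun i => ?_, fun h => ?_, fun i => ?_⟩
  · by_cases hi : i = a
    · subst hi; simpa using hρ
    · simpa [hi] using hν i
  · have := h.2 p (hP ▸ subset_convexHull ℝ _ hp)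
    rw [hpay, hpay, ha, zero_mul, add_zero] at this
    rw [← lt_sub_iff_add_lt, div_lt_iff₀ hpa] at hlt
    linarith
  · by_cases hi : i = a
    · exact Or.inl (hi ▸ ha)
    · exact Or.inr (by simp [hi])

/-- The single constraint from `ν'` forces a total weight of at least `1 / I` off `pstar`, where `I`
sums the divergences over the arms, and each unit of that weight costs at least the smallest
positive gap `δ` over `E`. Finiteness of `I` makes `δ / I` positive. -/
theorem lowerConst_pos {E : Finset (Fin K → ℝ)}
    (hE : ∀ p ∈ E, p ∈ stdSimplex ℝ (Fin K)) (hP : P = convexHull ℝ (E : Set (Fin K → ℝ)))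
    {D : Set (ProbabilityMeasure ℝ)} {ν : Problem K} {pstar : Fin K → ℝ}
    (hpstar : Opt P ν = {pstar}) {ν' : Problem K} (hν' : ν' ∈ Conf P D ν pstar)
    (hkl : ∀ a, klDiv (ν a : Measure ℝ) (ν' a : Measure ℝ) < ∞) :
    0 < lowerConst P E D ν pstar := by
  classical
  have hcomp : IsCompact P := hP ▸ E.finite_toSet.isCompact_convexHull ℝ
  have hEP : ∀ e ∈ E, e ∈ P := fun e he => hP ▸ subset_convexHull ℝ _ he
  have hgap : ∀ e ∈ E, e ≠ pstar → 0 < gap P ν e := fun e he hne =>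
    (gap_nonneg hcomp ν (hEP e he)).lt_of_ne fun h => hne <| by
      simpa [hpstar] using (gap_eq_zero_iff hcomp ν (hEP e he)).1 h.symm
  set I : ℝ≥0∞ := ∑ a, klDiv (ν a : Measure ℝ) (ν' a : Measure ℝ)
  have hI : I ≠ ∞ := ENNReal.sum_ne_top.2 fun a _ => (hkl a).ne
  obtain ⟨δ, hδ, hδle⟩ : ∃ δ : ℝ, 0 < δ ∧ ∀ e ∈ E, e ≠ pstar → δ ≤ gap P ν e := by
    rcases (E.filter (· ≠ pstar)).eq_empty_or_nonempty with h | h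
    · refine ⟨1, one_pos, fun e he hne => ?_⟩
      exact absurd (Finset.mem_filter.2 ⟨he, hne⟩) (h ▸ Finset.notMem_empty e)
    · obtain ⟨e, he, hmin⟩ := Finset.exists_min_image _ (gap P ν) h
      rw [Finset.mem_filter] at he
      exact ⟨_, hgap e he.1 he.2, fun e' h1 h2 => hmin e' (Finset.mem_filter.2 ⟨h1, h2⟩)⟩
  have hpos : 0 < ENNReal.ofReal δ / I :=
    ENNReal.div_pos (by simpa using hδ) hI
  refine hpos.trans_le (le_iInf₂ fun n hn => ENNReal.div_le_of_le_mul ?_)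
  have h1 : 1 ≤ ∑ p : E with p.1 ≠ pstar, (n p : ℝ≥0∞) * I := by
    refine (hn ν' hν').trans (Finset.sum_le_sum fun p _ => mul_le_mul_right ?_ _)
    refine (Finset.sum_le_sum fun a _ => ?_).trans
      (Finset.sum_le_sum_of_subset (Finset.filter_subset _ _))
    refine mul_le_of_le_one_left zero_le ?_
    rw [ENNReal.ofReal_le_one]
    exact (le_abs_self _).trans (abs_coord_le_one ⟨p.1, hE p.1 p.2⟩ a)
  calc ENNReal.ofReal δ ≤ ENNReal.ofReal δ * ∑ p : E with p.1 ≠ pstar, (n p : ℝ≥0∞) * I :=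
        le_mul_of_one_le_right zero_le h1
    _ = (∑ p : E with p.1 ≠ pstar, ENNReal.ofReal δ * (n p : ℝ≥0∞)) * I := by
        rw [← Finset.sum_mul, ← Finset.mul_sum, mul_assoc]
    _ ≤ _ := by
        gcongr ?_ * _
        refine (Finset.sum_le_sum fun p hp => ?_).trans
          (Finset.sum_le_sum_of_subset (Finset.filter_subset _ _))
        gcongr
        exact hδle p.1 p.2 (Finset.mem_filter.1 hp).2

end DivBandit

theorem theorem2 {K : ℕ}
    (P : Set (Fin K → ℝ)) (E : Finset (Fin K → ℝ))
    (hE : ∀ p ∈ E, p ∈ stdSimplex ℝ (Fin K))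
    (hP : P = convexHull ℝ (E : Set (Fin K → ℝ)))
    (hcharge : ∀ a : Fin K, ∃ p ∈ E, 0 < p a)
    (D : Set (ProbabilityMeasure ℝ))
    (hmoment : ∀ ρ ∈ D, Integrable (fun y : ℝ => y) (ρ : Measure ℝ))
    (hD : DivBandit.FiniteKLAlternative P D)
    (ν : DivBandit.Problem K) (hν : DivBandit.InModel D ν)
    (pstar : Fin K → ℝ) (hpstar : DivBandit.Opt P ν = {pstar}) :
    (∀ ψ : DivBandit.Strategy K P, DivBandit.IsUFC D ψ →
      (DivBandit.lowerConst P E D ν pstar : EReal) ≤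
        liminf (fun T : ℕ => ((DivBandit.regret ψ ν T / Real.log T : ℝ) : EReal)) atTop) ∧
    ((∀ a, 0 < pstar a) → DivBandit.lowerConst P E D ν pstar = 0) ∧
    (¬ BddAbove (DivBandit.mean '' D) → (∃ a, pstar a = 0) →
      0 < DivBandit.lowerConst P E D ν pstar) := by
  refine ⟨fun ψ hψ => DivBandit.lowerConst_le_liminf hE hP hcharge hν hpstar hψ,
    DivBandit.lowerConst_eq_zero hpstar, fun hunb ⟨a, ha⟩ => ?_⟩
  have hne := DivBandit.conf_nonempty hP hcharge hν hunb ha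
  obtain ⟨ν', hν', hkl⟩ := (hD ν pstar hν hpstar).resolve_left hne.ne_empty
  exact DivBandit.lowerConst_pos hE hP hpstar hν' hkl
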